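/- There is a universal constant $C>0$ such that the following holds. Let $d\ge 1$, let $\rho\in\mathbb{C}^{d\times d}$ be a density matrix (positive semidefinite with $\operatorname{Tr}\rho=1$), and let $\mathcal D(\rho)$ be the distribution on the unit sphere of $\mathbb{C}^d$ with density $d\,\langle v|\rho|v\rangle$ with respect to the uniform (Haar) probability measure $\mathrm{d}v$ on that sphere, i.e. the distribution of the outcome when $\rho$ is measured with the uniform POVM $\{d\,|v\rangle\langle v|\,\mathrm{d}v\}$. Let $O\in\mathbb{C}^{d\times d}$ be Hermitian, with Hilbert–Schmidt norm $\|O\|_{HS}=\sqrt{\operatorname{Tr}[O^\dagger O]}$. Then for every integer $h\ge 2$, $$\mathbb{E}_{v\sim\mathcal D(\rho)}\Big[\big(\langle v|O|v\rangle-\mathbb{E}_{v\sim\mathcal D(\rho)}\langle v|O|v\rangle\big)^h\Big]\le\left(\frac{C\,h\,\|O\|_{HS}}{d+1}\right)^h .$$ Moreover, $\langle v|O|v\rangle$ is sub-exponential with parameter $K=C\|O\|_{HS}/(d+1)$: for all real $s$ with $|s|K\le 1$, $$\mathbb{E}_{v\sim\mathcal D(\rho)}\exp\!\Big(s\big(\langle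 v|O|v\rangle-\mathbb{E}_{v\sim\mathcal D(\rho)}\langle v|O|v\rangle\big)\Big)\le \exp\!\big(s^2K^2/2\big).$$ -/

import Mathlib

open MeasureTheory ProbabilityTheory
open scoped Matrix ComplexOrder

noncomputable section

/-- The unit sphere of `ℂ^d` (with its Hermitian norm): the pure state vectors `|v⟩`. -/
abbrev UnitSphere (d : ℕ) : Type :=
  Metric.sphere (0 : EuclideanSpace ℂ (Fin d)) 1

/-- The expectation value `⟨v|A|v⟩ = ∑ i j, conj (v i) * A i j * v j`, as a real number
(its imaginary part vanishes when `A` is Hermitian). -/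
def expVal {d : ℕ} (A : Matrix (Fin d) (Fin d) ℂ) (v : UnitSphere d) : ℝ :=
  (star (v.1.ofLp) ⬝ᵥ (A *ᵥ v.1.ofLp)).re

/-- The Hilbert-Schmidt norm `√(Tr[A† A])`. -/
def hsNorm {d : ℕ} (A : Matrix (Fin d) (Fin d) ℂ) : ℝ :=
  Real.sqrt ((Aᴴ * A).trace).re

/-- Density matrices: positive semidefinite (in particular Hermitian) with trace one. -/
def IsDensityMatrix {d : ℕ} (ρ : Matrix (Fin d) (Fin d) ℂ) : Prop :=
  ρ.PosSemidef ∧ ρ.trace = 1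

/-- The uniform (Haar) measure `dv` on the unit sphere of `ℂ^d`: the surface measure induced by
Lebesgue measure, normalized to total mass one. -/
def uniformSphere (d : ℕ) : Measure (UnitSphere d) :=
  ((volume : Measure (EuclideanSpace ℂ (Fin d))).toSphere Set.univ)⁻¹ •
    (volume : Measure (EuclideanSpace ℂ (Fin d))).toSphere

instance uniformSphere_isProbabilityMeasure (d : ℕ) [NeZero d] :
    IsProbabilityMeasure (uniformSphere d) := by
  constructor
  have h0 : (volume : Measure (EuclideanSpace ℂ (Fin d))).toSphere Set.univ ≠ 0 := by
    rw [Ne, Measure.measure_univ_eq_zero, Measure.toSphere_eq_zero_iff_finrank]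
    have : Module.finrank ℝ (EuclideanSpace ℂ (Fin d)) = 2 * d := by
      rw [finrank_real_of_complex]; simp
    have := NeZero.ne d
    omega
  simp only [uniformSphere, Measure.smul_apply, smul_eq_mul]
  exact ENNReal.inv_mul_cancel h0 (measure_ne_top _ _)

/-- The distribution `D(ρ)` of the outcome `v` when `ρ` is measured with the uniform POVM
`{d |v⟩⟨v| dv}`: it has density `d ⟨v|ρ|v⟩` with respect to the uniform measure `dv`. -/
def uniformPOVM {d : ℕ} (ρ : Matrix (Fin d) (Fin d) ℂ) : Measure (UnitSphere d) :=
  (uniformSphere d).withDensity fun v => ENNReal.ofReal ((d : ℝ) * expVal ρ v)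

/-- `X` is sub-exponential with parameter `K` under `μ`: the centered variable
`Y = X - E[X]` satisfies `E[exp (s Y)] ≤ exp (s² K² / 2)` for all real `s` with `|s| ≤ 1 / K`
(all real `s` if `K = 0`); that the expectation exists is part of the definition. -/
def IsSubExponential {Ω : Type*} [MeasurableSpace Ω] (X : Ω → ℝ) (K : ℝ) (μ : Measure Ω) : Prop :=
  Integrable X μ ∧ 0 ≤ K ∧ ∀ s : ℝ, |s| * K ≤ 1 →
    Integrable (fun ω => Real.exp (s * (X ω - ∫ ω', X ω' ∂μ))) μ ∧
    ∫ ω, Real.exp (s * (X ω - ∫ ω', X ω' ∂μ)) ∂μ ≤ Real.exp (s ^ 2 * K ^ 2 / 2)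

end

/-! Sphere averages of homogeneous functions are Gaussian averages up to a factorial ratio
(`integral_sphere_eq`), and Gaussian integrals of `exp (quadForm B)` are explicit: diagonalising
gives `π ^ d / det (1 - B)`, at most `π ^ d * exp (tr B + ‖B‖²)` in Hilbert–Schmidt norm when `‖B‖ ≤
1/2` (`integral_exp_quadForm_le`).

For traceless `O`, the weighted moment `⟨ρ⟩ |⟨O⟩| ^ h` is dominated pointwise by `h!` times
exponentials of `± t O + ρ / 4` with `t ~ 1 / ‖O‖`. Tracelessness removes the first-order term in
`O`, so only the Hilbert–Schmidt norm enters. Returning to the sphere, the factor `d (d-1)! / (d+h)!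
≤ (d+1) ^ (-h)` supplies the dimensional gain (`integral_sphere_expVal_mul_pow_le`).

Subtracting `tr O / d` from a general `O` gives factorial moment bounds about that centre; they pass
to the true mean (`integral_abs_sub_mean_pow_le`). Then `h! ≤ h ^ h` gives the central moments, and
summing the exponential series gives the sub-exponential bound. -/

/-- The quadratic form `x ↦ Re ⟨x|A|x⟩` on all of `ℂ^d`. -/
noncomputable def quadForm {d : ℕ} (A : Matrix (Fin d) (Fin d) ℂ) (x : EuclideanSpace ℂ (Fin d)) : ℝ :=
  (star x.ofLp ⬝ᵥ (A *ᵥ x.ofLp)).re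

/-! ### Quadratic forms, spectra and the Hilbert–Schmidt norm -/

section quadForm
variable {d : ℕ}

lemma expVal_eq_quadForm (A : Matrix (Fin d) (Fin d) ℂ) (v : UnitSphere d) :
    expVal A v = quadForm A v.1 := rfl

lemma quadForm_add (A B : Matrix (Fin d) (Fin d) ℂ) (x : EuclideanSpace ℂ (Fin d)) :
    quadForm (A + B) x = quadForm A x + quadForm B x := by
  simp [quadForm, Matrix.add_mulVec, dotProduct_add]

lemma quadForm_smul (c : ℝ) (A : Matrix (Fin d) (Fin d) ℂ) (x : EuclideanSpace ℂ (Fin d)) :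
    quadForm (c • A) x = c * quadForm A x := by
  simp [quadForm, Matrix.smul_mulVec, dotProduct_smul]

lemma quadForm_apply_smul (A : Matrix (Fin d) (Fin d) ℂ) (r : ℝ) (x : EuclideanSpace ℂ (Fin d)) :
    quadForm A (r • x) = r ^ 2 * quadForm A x := by
  have : (r • x).ofLp = r • x.ofLp := rfl
  simp only [quadForm, this, Matrix.mulVec_smul, star_smul, dotProduct_smul, smul_dotProduct]
  simp
  ring

lemma quadForm_one (x : EuclideanSpace ℂ (Fin d)) : quadForm 1 x = ‖x‖ ^ 2 := by
  rw [EuclideanSpace.norm_sq_eq]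
  simp [quadForm, dotProduct, ← Complex.normSq_eq_norm_sq, Complex.normSq_apply]

lemma continuous_quadForm (A : Matrix (Fin d) (Fin d) ℂ) : Continuous (quadForm A) := by
  unfold quadForm dotProduct Matrix.mulVec dotProduct
  fun_prop

lemma quadForm_nonneg {A : Matrix (Fin d) (Fin d) ℂ} (hA : A.PosSemidef)
    (x : EuclideanSpace ℂ (Fin d)) : 0 ≤ quadForm A x := by
  have := hA.dotProduct_mulVec_nonneg x.ofLp
  exact (Complex.le_def.1 this).1

lemma quadForm_eq_sum_eigenvalues {A : Matrix (Fin d) (Fin d) ℂ} (hA : A.IsHermitian)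
    (x : EuclideanSpace ℂ (Fin d)) :
    quadForm A x = ∑ i, hA.eigenvalues i * ‖hA.eigenvectorBasis.repr x i‖ ^ 2 := by
  have key : ∀ i, inner ℂ (hA.eigenvectorBasis i) (Matrix.toEuclideanLin A x) =
      hA.eigenvalues i * inner ℂ (hA.eigenvectorBasis i) x := by
    intro i
    rw [← (Matrix.isSymmetric_toEuclideanLin_iff.mpr hA) _ _]
    have : Matrix.toEuclideanLin A (hA.eigenvectorBasis i) =
        (hA.eigenvalues i : ℂ) • hA.eigenvectorBasis i := by
      ext j
      simpa [Matrix.toLpLin_apply] using congrFun (hA.mulVec_eigenvectorBasis i) j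
    rw [this, inner_smul_left]
    simp
  have h1 : quadForm A x = (inner ℂ x (Matrix.toEuclideanLin A x)).re := by
    simp [quadForm, EuclideanSpace.inner_eq_star_dotProduct, Matrix.toLpLin_apply, dotProduct_comm]
  rw [h1, ← hA.eigenvectorBasis.sum_inner_mul_inner, Complex.re_sum]
  refine Finset.sum_congr rfl fun i _ ↦ ?_
  rw [key, hA.eigenvectorBasis.repr_apply_apply, ← inner_conj_symm, ← Complex.normSq_eq_norm_sq,
    mul_left_comm, mul_comm (starRingEnd ℂ _), Complex.mul_conj, ← Complex.ofReal_mul,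
    Complex.ofReal_re]

lemma trace_conjTranspose_mul_self_re (A : Matrix (Fin d) (Fin d) ℂ) :
    ((Aᴴ * A).trace).re = ∑ i, ∑ j, ‖A i j‖ ^ 2 := by
  rw [Finset.sum_comm]
  simp [Matrix.trace, Matrix.mul_apply, ← Complex.normSq_eq_norm_sq, Complex.normSq_apply]

lemma hsNorm_sq (A : Matrix (Fin d) (Fin d) ℂ) : hsNorm A ^ 2 = ∑ i, ∑ j, ‖A i j‖ ^ 2 := by
  rw [hsNorm, trace_conjTranspose_mul_self_re, Real.sq_sqrt (by positivity)]

lemma hsNorm_nonneg (A : Matrix (Fin d) (Fin d) ℂ) : 0 ≤ hsNorm A := Real.sqrt_nonneg _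

lemma hsNorm_sq_eq_trace (A : Matrix (Fin d) (Fin d) ℂ) :
    hsNorm A ^ 2 = ((Aᴴ * A).trace).re := by
  rw [hsNorm_sq, trace_conjTranspose_mul_self_re]

lemma eq_zero_of_hsNorm_eq_zero {A : Matrix (Fin d) (Fin d) ℂ} (h : hsNorm A = 0) : A = 0 := by
  have h2 := hsNorm_sq A
  rw [h, zero_pow two_ne_zero, eq_comm,
    Finset.sum_eq_zero_iff_of_nonneg fun _ _ ↦ Finset.sum_nonneg fun _ _ ↦ sq_nonneg _] at h2
  ext i j
  have := (Finset.sum_eq_zero_iff_of_nonneg fun _ _ ↦ sq_nonneg _).1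
    (h2 i (Finset.mem_univ i)) j (Finset.mem_univ j)
  simpa using this

lemma hsNorm_add_sq_le (A B : Matrix (Fin d) (Fin d) ℂ) :
    hsNorm (A + B) ^ 2 ≤ 2 * hsNorm A ^ 2 + 2 * hsNorm B ^ 2 := by
  simp only [hsNorm_sq, Finset.mul_sum, ← Finset.sum_add_distrib]
  refine Finset.sum_le_sum fun i _ ↦ Finset.sum_le_sum fun j _ ↦ ?_
  rw [Matrix.add_apply]
  nlinarith [norm_add_le (A i j) (B i j), norm_nonneg (A i j + B i j),
    sq_nonneg (‖A i j‖ - ‖B i j‖)]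

lemma hsNorm_smul_sq (c : ℝ) (A : Matrix (Fin d) (Fin d) ℂ) :
    hsNorm (c • A) ^ 2 = c ^ 2 * hsNorm A ^ 2 := by
  simp [hsNorm_sq, Finset.mul_sum, mul_pow]

lemma hsNorm_sq_eq_sum_eigenvalues {A : Matrix (Fin d) (Fin d) ℂ} (hA : A.IsHermitian) :
    hsNorm A ^ 2 = ∑ i, hA.eigenvalues i ^ 2 := by
  rw [hsNorm_sq_eq_trace, hA.eq]
  conv_lhs => rw [hA.spectral_theorem, ← map_mul, Unitary.conjStarAlgAut_apply, Matrix.trace_mul_cycle]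
  rw [Unitary.coe_star_mul_self, one_mul, Matrix.diagonal_mul_diagonal, Matrix.trace_diagonal]
  simp [← sq, ← Complex.ofReal_pow]

lemma trace_re_eq_sum_eigenvalues {A : Matrix (Fin d) (Fin d) ℂ} (hA : A.IsHermitian) :
    A.trace.re = ∑ i, hA.eigenvalues i := by
  rw [hA.trace_eq_sum_eigenvalues]
  simp

lemma IsDensityMatrix.hsNorm_sq_le_one {ρ : Matrix (Fin d) (Fin d) ℂ} (hρ : IsDensityMatrix ρ) :
    hsNorm ρ ^ 2 ≤ 1 := by
  have hH := hρ.1.isHermitian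
  have htr : ∑ i, hH.eigenvalues i = 1 := by
    rw [← trace_re_eq_sum_eigenvalues, hρ.2, Complex.one_re]
  rw [hsNorm_sq_eq_sum_eigenvalues hH, ← one_pow 2, ← htr]
  exact Finset.sum_sq_le_sq_sum_of_nonneg fun i _ ↦ hρ.1.eigenvalues_nonneg i

/-- Removing the scalar part is the orthogonal projection onto traceless matrices: `tr (A - c)² = tr
A² - c² d`. -/
lemma hsNorm_sub_trace_sq_le [NeZero d] {A : Matrix (Fin d) (Fin d) ℂ} (hA : A.IsHermitian) :
    hsNorm (A + (-(A.trace.re / d)) • (1 : Matrix (Fin d) (Fin d) ℂ)) ≤ hsNorm A := by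
  set c := A.trace.re / d with hc
  have hd : (d : ℝ) ≠ 0 := by exact_mod_cast NeZero.ne d
  rw [← sq_le_sq₀ (hsNorm_nonneg _) (hsNorm_nonneg _), hsNorm_sq_eq_trace, hsNorm_sq_eq_trace]
  have h1 : (A + (-c) • (1 : Matrix (Fin d) (Fin d) ℂ))ᴴ = A + (-c) • 1 := by
    simp [Matrix.conjTranspose_add, hA.eq]
  rw [h1, hA.eq]
  have h2 : (A + (-c) • (1 : Matrix (Fin d) (Fin d) ℂ)) * (A + (-c) • 1) =
      A * A + (-(2 * c)) • A + (c ^ 2) • 1 := by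
    simp only [add_mul, mul_add, smul_mul_assoc, mul_smul_comm, one_mul, mul_one]
    module
  have h3 : A.trace.re = c * d := by rw [hc]; field_simp
  rw [h2]
  simp only [Matrix.trace_add, Matrix.trace_smul, Matrix.trace_one, Complex.add_re,
    Complex.smul_re, Fintype.card_fin, Complex.natCast_re, smul_eq_mul, h3]
  nlinarith [mul_nonneg (sq_nonneg c) (Nat.cast_nonneg (α := ℝ) d)]

end quadForm

/-! ### Gaussian integrals on `ℂ^d` -/

section Gaussian
variable {d : ℕ}

/-- Polar coordinates: homogeneity of degree `2m` splits off the radial integral of `exp (-r²) r ^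
(2(d+m) - 1)`, which is `Γ(d+m) / 2`. -/
lemma integral_exp_neg_sq_norm_mul_of_homogeneous [NeZero d] {F : EuclideanSpace ℂ (Fin d) → ℝ}
    (m : ℕ) (hF : ∀ r : ℝ, 0 < r → ∀ x, F (r • x) = r ^ (2 * m) * F x) :
    ∫ x, Real.exp (-‖x‖ ^ 2) * F x =
      (∫ v : UnitSphere d, F v.1 ∂(volume : Measure (EuclideanSpace ℂ (Fin d))).toSphere) *
        ((d + m - 1).factorial / 2) := by
  have hd : 0 < d := Nat.pos_of_ne_zero (NeZero.ne d)
  have hdim : Module.finrank ℝ (EuclideanSpace ℂ (Fin d)) = 2 * d := by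
    rw [finrank_real_of_complex]; simp
  have : Nontrivial (EuclideanSpace ℂ (Fin d)) :=
    Module.nontrivial_of_finrank_pos (R := ℝ) (by omega)
  set μ : Measure (EuclideanSpace ℂ (Fin d)) := volume
  set G : UnitSphere d × Set.Ioi (0 : ℝ) → ℝ := fun p ↦
    F p.1.1 * (Real.exp (-p.2.1 ^ 2) * p.2.1 ^ (2 * m)) with hG
  have key : ∀ x : ({0}ᶜ : Set (EuclideanSpace ℂ (Fin d))),
      Real.exp (-‖x.1‖ ^ 2) * F x.1 = G (homeomorphUnitSphereProd _ x) := by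
    intro x
    have hx : 0 < ‖x.1‖ := norm_pos_iff.2 x.2
    have h1 : F x.1 = ‖x.1‖ ^ (2 * m) * F (‖x.1‖⁻¹ • x.1) := by
      rw [← hF _ hx, smul_smul, mul_inv_cancel₀ hx.ne', one_smul]
    simp only [hG, homeomorphUnitSphereProd_apply_snd_coe, homeomorphUnitSphereProd_apply_fst_coe]
    rw [h1]
    ring
  calc ∫ x, Real.exp (-‖x‖ ^ 2) * F x ∂μ
      = ∫ x : ({0}ᶜ : Set (EuclideanSpace ℂ (Fin d))),
          Real.exp (-‖x.1‖ ^ 2) * F x.1 ∂(μ.comap (↑)) := by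
        rw [integral_subtype_comap (measurableSet_singleton _).compl
          fun x ↦ Real.exp (-‖x‖ ^ 2) * F x, restrict_compl_singleton]
    _ = ∫ p, G p ∂μ.toSphere.prod (.volumeIoiPow (2 * d - 1)) := by
        simp_rw [key]
        have := μ.measurePreserving_homeomorphUnitSphereProd.integral_comp
          (Homeomorph.measurableEmbedding _) G
        rwa [hdim] at this
    _ = (∫ v : UnitSphere d, F v.1 ∂μ.toSphere) * ∫ r : Set.Ioi (0 : ℝ),
          Real.exp (-r.1 ^ 2) * r.1 ^ (2 * m) ∂(.volumeIoiPow (2 * d - 1)) :=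
        integral_prod_mul (fun v : UnitSphere d ↦ F v.1)
          fun r : Set.Ioi (0 : ℝ) ↦ Real.exp (-r.1 ^ 2) * r.1 ^ (2 * m)
    _ = _ := by
        congr 1
        simp only [Measure.volumeIoiPow, ENNReal.ofReal]
        rw [integral_withDensity_eq_integral_smul (measurable_subtype_coe.pow_const _).real_toNNReal,
          integral_subtype_comap measurableSet_Ioi fun a : ℝ ↦
            Real.toNNReal (a ^ (2 * d - 1)) • (Real.exp (-a ^ 2) * a ^ (2 * m))]
        have h2 := integral_rpow_mul_exp_neg_rpow (p := 2) (q := (2 * (d + m) - 1 : ℕ))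
          two_pos (by have := Nat.cast_nonneg (α := ℝ) (2 * (d + m) - 1); linarith)
        have h3 : (((2 * (d + m) - 1 : ℕ) : ℝ) + 1) / 2 = ((d + m - 1 : ℕ) : ℝ) + 1 := by
          rw [Nat.cast_sub (by omega), Nat.cast_sub (by omega)]
          push_cast
          ring
        rw [h3, Real.Gamma_nat_eq_factorial] at h2
        rw [div_eq_inv_mul, ← one_div, ← h2]
        refine setIntegral_congr_fun measurableSet_Ioi fun x hx ↦ ?_
        have hx : 0 < x := hx
        simp only [NNReal.smul_def, Real.coe_toNNReal _ (pow_nonneg hx.le _), smul_eq_mul,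
          Real.rpow_natCast, Real.rpow_two]
        rw [mul_left_comm, ← pow_add, mul_comm]
        congr 2
        omega

lemma integral_comp_repr (b : OrthonormalBasis (Fin d) ℂ (EuclideanSpace ℂ (Fin d)))
    (g : EuclideanSpace ℂ (Fin d) → ℝ) :
    ∫ x, g (b.repr x) = ∫ x, g x := by
  let e : EuclideanSpace ℂ (Fin d) ≃ₗᵢ[ℝ] EuclideanSpace ℂ (Fin d) :=
    { b.repr.toLinearEquiv.restrictScalars ℝ with norm_map' := b.repr.norm_map }
  exact e.measurePreserving.integral_comp e.toHomeomorph.measurableEmbedding g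

lemma integrable_comp_repr (b : OrthonormalBasis (Fin d) ℂ (EuclideanSpace ℂ (Fin d)))
    {g : EuclideanSpace ℂ (Fin d) → ℝ} (hg : Integrable g) :
    Integrable fun x ↦ g (b.repr x) := by
  let e : EuclideanSpace ℂ (Fin d) ≃ₗᵢ[ℝ] EuclideanSpace ℂ (Fin d) :=
    { b.repr.toLinearEquiv.restrictScalars ℝ with norm_map' := b.repr.norm_map }
  exact e.measurePreserving.integrable_comp_of_integrable hg

lemma integrable_exp_neg_mul_sq_norm_complex {b : ℝ} (hb : 0 < b) :
    Integrable fun z : ℂ ↦ Real.exp (-b * ‖z‖ ^ 2) := by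
  by_contra h
  have h1 := GaussianFourier.integral_rexp_neg_mul_sq_norm (V := ℂ) hb
  rw [integral_undef h] at h1
  have : 0 < (Real.pi / b) ^ (Module.finrank ℝ ℂ / 2 : ℝ) := by positivity
  linarith

lemma integral_exp_neg_mul_sq_norm_complex {b : ℝ} (hb : 0 < b) :
    ∫ z : ℂ, Real.exp (-b * ‖z‖ ^ 2) = Real.pi / b := by
  rw [GaussianFourier.integral_rexp_neg_mul_sq_norm hb]
  simp

lemma integral_exp_neg_sq_norm :
    ∫ x : EuclideanSpace ℂ (Fin d), Real.exp (-‖x‖ ^ 2) = Real.pi ^ d := by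
  have := GaussianFourier.integral_rexp_neg_mul_sq_norm (V := EuclideanSpace ℂ (Fin d)) one_pos
  have hdim : Module.finrank ℝ (EuclideanSpace ℂ (Fin d)) = 2 * d := by
    rw [finrank_real_of_complex]; simp
  simpa [hdim] using this

lemma integral_exp_neg_sum_mul_sq_norm_pi {a : Fin d → ℝ} (ha : ∀ i, 0 < a i) :
    ∫ x : Fin d → ℂ, Real.exp (∑ i, -a i * ‖x i‖ ^ 2) = ∏ i, Real.pi / a i := by
  simp_rw [Real.exp_sum]
  rw [integral_fintype_prod_volume_eq_prod (f := fun i (z : ℂ) ↦ Real.exp (-a i * ‖z‖ ^ 2))]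
  exact Finset.prod_congr rfl fun i _ ↦ integral_exp_neg_mul_sq_norm_complex (ha i)

/-- The Lebesgue measure of `ℂ^d` as a Euclidean space is the product measure. -/
lemma volume_preserving_toLp_complex :
    MeasurePreserving (WithLp.toLp 2 : (Fin d → ℂ) → EuclideanSpace ℂ (Fin d)) := by
  let e : (Fin d → ℂ) ≃L[ℝ] EuclideanSpace ℂ (Fin d) :=
    (PiLp.continuousLinearEquiv 2 ℝ (fun _ : Fin d ↦ ℂ)).symm
  have he : ∀ x, e x = WithLp.toLp 2 x := fun _ ↦ rfl
  have hm : MeasurableEmbedding e := e.toHomeomorph.measurableEmbedding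
  have : (Measure.map e (volume : Measure (Fin d → ℂ))).IsAddHaarMeasure :=
    e.isAddHaarMeasure_map _
  -- Uniqueness of Haar measure leaves one scalar `c`; evaluating the same Gaussian integral against
  -- both measures forces `c = 1`.
  have h := Measure.isAddLeftInvariant_eq_smul
    (volume : Measure (EuclideanSpace ℂ (Fin d))) (Measure.map e volume)
  set c := (volume : Measure (EuclideanSpace ℂ (Fin d))).addHaarScalarFactor (Measure.map e volume)
  have h1 := integral_exp_neg_sq_norm (d := d)
  have h2 := integral_exp_neg_sum_mul_sq_norm_pi (d := d) (a := fun _ ↦ 1) fun _ ↦ one_pos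
  have h3 : ∀ x : Fin d → ℂ, -‖e x‖ ^ 2 = ∑ i, -(1 : ℝ) * ‖x i‖ ^ 2 := by
    intro x
    simp [EuclideanSpace.norm_sq_eq, he]
  rw [h, integral_smul_nnreal_measure, hm.integral_map] at h1
  simp_rw [h3] at h1
  rw [h2] at h1
  have hpi : (Real.pi ^ d) ≠ 0 := by positivity
  have hc1 : c = 1 := by
    simpa [NNReal.smul_def, hpi] using h1
  rw [hc1, one_smul] at h
  exact ⟨hm.measurable, h.symm⟩

lemma measurableEmbedding_toLp_complex :
    MeasurableEmbedding (WithLp.toLp 2 : (Fin d → ℂ) → EuclideanSpace ℂ (Fin d)) :=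
  (PiLp.continuousLinearEquiv 2 ℝ (fun _ : Fin d ↦ ℂ)).symm.toHomeomorph.measurableEmbedding

lemma integrable_exp_neg_sum_mul_sq_norm {a : Fin d → ℝ} (ha : ∀ i, 0 < a i) :
    Integrable fun x : EuclideanSpace ℂ (Fin d) ↦ Real.exp (∑ i, -a i * ‖x i‖ ^ 2) := by
  have h := Integrable.fintype_prod (μ := fun _ : Fin d ↦ (volume : Measure ℂ))
    fun i ↦ integrable_exp_neg_mul_sq_norm_complex (ha i)
  rw [← volume_preserving_toLp_complex.integrable_comp_emb measurableEmbedding_toLp_complex]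
  simp_rw [Function.comp_def, Real.exp_sum]
  exact h

lemma integral_exp_neg_sum_mul_sq_norm {a : Fin d → ℝ} (ha : ∀ i, 0 < a i) :
    ∫ x : EuclideanSpace ℂ (Fin d), Real.exp (∑ i, -a i * ‖x i‖ ^ 2) = ∏ i, Real.pi / a i := by
  rw [← volume_preserving_toLp_complex.integral_comp measurableEmbedding_toLp_complex]
  exact integral_exp_neg_sum_mul_sq_norm_pi ha

lemma exp_quadForm_eq {B : Matrix (Fin d) (Fin d) ℂ} (hB : B.IsHermitian)
    (x : EuclideanSpace ℂ (Fin d)) :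
    Real.exp (-‖x‖ ^ 2 + quadForm B x) =
      Real.exp (∑ i, -(1 - hB.eigenvalues i) * ‖hB.eigenvectorBasis.repr x i‖ ^ 2) := by
  rw [quadForm_eq_sum_eigenvalues hB, ← hB.eigenvectorBasis.repr.norm_map x,
    EuclideanSpace.norm_sq_eq, ← Finset.sum_neg_distrib, ← Finset.sum_add_distrib]
  congr 1
  exact Finset.sum_congr rfl fun i _ ↦ by ring

lemma abs_eigenvalues_le_hsNorm {B : Matrix (Fin d) (Fin d) ℂ} (hB : B.IsHermitian) (i : Fin d) :
    |hB.eigenvalues i| ≤ hsNorm B := by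
  refine abs_le_of_sq_le_sq ?_ (hsNorm_nonneg B)
  rw [hsNorm_sq_eq_sum_eigenvalues hB]
  exact Finset.single_le_sum (f := fun i ↦ hB.eigenvalues i ^ 2) (fun _ _ ↦ sq_nonneg _)
    (Finset.mem_univ i)

lemma integrable_exp_quadForm {B : Matrix (Fin d) (Fin d) ℂ} (hB : B.IsHermitian)
    (h : hsNorm B < 1) :
    Integrable fun x : EuclideanSpace ℂ (Fin d) ↦ Real.exp (-‖x‖ ^ 2 + quadForm B x) := by
  simp_rw [exp_quadForm_eq hB]
  refine integrable_comp_repr hB.eigenvectorBasis (integrable_exp_neg_sum_mul_sq_norm fun i ↦ ?_)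
  linarith [le_abs_self (hB.eigenvalues i), abs_eigenvalues_le_hsNorm hB i]

/-- In an eigenbasis the integral factors into one-dimensional complex Gaussians, convergent because
every eigenvalue is below 1. -/
lemma integral_exp_quadForm {B : Matrix (Fin d) (Fin d) ℂ} (hB : B.IsHermitian)
    (h : hsNorm B < 1) :
    ∫ x : EuclideanSpace ℂ (Fin d), Real.exp (-‖x‖ ^ 2 + quadForm B x) =
      ∏ i, Real.pi / (1 - hB.eigenvalues i) := by
  simp_rw [exp_quadForm_eq hB]
  rw [integral_comp_repr hB.eigenvectorBasis
    (fun y ↦ Real.exp (∑ i, -(1 - hB.eigenvalues i) * ‖y i‖ ^ 2))]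
  refine integral_exp_neg_sum_mul_sq_norm fun i ↦ ?_
  linarith [le_abs_self (hB.eigenvalues i), abs_eigenvalues_le_hsNorm hB i]

lemma inv_one_sub_le_exp {x : ℝ} (hx : |x| ≤ 1 / 2) : (1 - x)⁻¹ ≤ Real.exp (x + x ^ 2) := by
  obtain ⟨h1, h2⟩ := abs_le.1 hx
  refine inv_le_of_inv_le₀ (Real.exp_pos _) ?_
  rw [inv_le_iff_one_le_mul₀ (Real.exp_pos _)]
  -- For `x ≤ 0`, `exp y ≥ 1 + y` suffices, since `(1 - x)(1 + x + x²) = 1 - x³ ≥ 1`. For `x ≥ 0`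
  -- the quadratic term of `exp` must compensate `-x³`.
  rcases le_total x 0 with hx0 | hx0
  · have := mul_le_mul_of_nonneg_left (Real.add_one_le_exp (x + x ^ 2)) (by linarith : 0 ≤ 1 - x)
    nlinarith [mul_nonneg (neg_nonneg.2 hx0) (sq_nonneg x)]
  · have := mul_le_mul_of_nonneg_left (Real.quadratic_le_exp_of_nonneg (x := x + x ^ 2)
      (by positivity)) (by linarith : 0 ≤ 1 - x)
    have h3 : 0 ≤ x ^ 2 * ((1 - x) * (1 + x) ^ 2 / 2 - x) := by
      refine mul_nonneg (sq_nonneg x) ?_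
      nlinarith [mul_nonneg hx0 (sub_nonneg.2 h2), mul_nonneg (sq_nonneg x) (sub_nonneg.2 h2)]
    nlinarith

lemma integral_exp_quadForm_le {B : Matrix (Fin d) (Fin d) ℂ} (hB : B.IsHermitian)
    (h : hsNorm B ≤ 1 / 2) :
    ∫ x : EuclideanSpace ℂ (Fin d), Real.exp (-‖x‖ ^ 2 + quadForm B x) ≤
      Real.pi ^ d * Real.exp (B.trace.re + hsNorm B ^ 2) := by
  have hpi := Real.pi_pos
  rw [integral_exp_quadForm hB (by linarith), trace_re_eq_sum_eigenvalues hB,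
    hsNorm_sq_eq_sum_eigenvalues hB, ← Finset.sum_add_distrib, Real.exp_sum]
  simp_rw [div_eq_mul_inv]
  rw [Finset.prod_mul_distrib, Finset.prod_const, Finset.card_univ, Fintype.card_fin]
  have hi := fun i ↦ (abs_eigenvalues_le_hsNorm hB i).trans h
  gcongr with i
  · refine fun i _ ↦ inv_nonneg.2 ?_
    linarith [le_abs_self (hB.eigenvalues i), hi i]
  · exact inv_one_sub_le_exp (hi i)

end Gaussian

/-! ### Transfer from Gaussian space to the sphere -/

section Sphere
variable {d : ℕ}

lemma integral_sphere_eq [NeZero d] {F : EuclideanSpace ℂ (Fin d) → ℝ}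
    (m : ℕ) (hF : ∀ r : ℝ, 0 < r → ∀ x, F (r • x) = r ^ (2 * m) * F x) :
    ∫ v, F v.1 ∂uniformSphere d =
      (d - 1).factorial / (d + m - 1).factorial *
        ((Real.pi ^ d)⁻¹ * ∫ x, Real.exp (-‖x‖ ^ 2) * F x) := by
  -- The case `F = 1` computes the total surface measure, hence the normalisation.
  have h0 := integral_exp_neg_sq_norm_mul_of_homogeneous (d := d) (F := fun _ ↦ 1) 0 (by simp)
  simp only [mul_one, integral_exp_neg_sq_norm, integral_const, smul_eq_mul, add_zero] at h0
  rw [integral_exp_neg_sq_norm_mul_of_homogeneous m hF, uniformSphere, integral_smul_measure, h0,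
    smul_eq_mul, ENNReal.toReal_inv]
  have h1 : ((volume : Measure (EuclideanSpace ℂ (Fin d))).toSphere Set.univ).toReal ≠ 0 := by
    intro h
    rw [Measure.real, h] at h0
    have : Real.pi ^ d ≠ 0 := by positivity
    simp [this] at h0
  have h2 := Nat.cast_ne_zero (R := ℝ).2 (d - 1).factorial_ne_zero
  have h3 := Nat.cast_ne_zero (R := ℝ).2 (d + m - 1).factorial_ne_zero
  rw [Measure.real]
  field_simp

lemma integrable_exp_neg_sq_norm_mul_sq_norm :
    Integrable fun x : EuclideanSpace ℂ (Fin d) ↦ Real.exp (-‖x‖ ^ 2) * ‖x‖ ^ 2 := by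
  have h := integrable_exp_neg_sum_mul_sq_norm (d := d) (a := fun _ ↦ 1 / 2) fun _ ↦ by norm_num
  refine (h.const_mul 2).mono' (by fun_prop) (.of_forall fun x ↦ ?_)
  have h1 : ∑ i, -(1 / 2 : ℝ) * ‖x i‖ ^ 2 = -(‖x‖ ^ 2 / 2) := by
    rw [EuclideanSpace.norm_sq_eq, ← Finset.mul_sum]
    ring
  rw [h1, Real.norm_of_nonneg (by positivity)]
  have h2 : Real.exp (-‖x‖ ^ 2) = Real.exp (-(‖x‖ ^ 2 / 2)) * Real.exp (-(‖x‖ ^ 2 / 2)) := by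
    rw [← Real.exp_add]; ring_nf
  have h3 := Real.add_one_le_exp (‖x‖ ^ 2 / 2)
  have h4 : Real.exp (-(‖x‖ ^ 2 / 2)) * Real.exp (‖x‖ ^ 2 / 2) = 1 := by
    rw [← Real.exp_add]; simp
  rw [h2]
  nlinarith [mul_le_mul_of_nonneg_left h3 (sq_nonneg (Real.exp (-(‖x‖ ^ 2 / 2)))),
    Real.exp_pos (-(‖x‖ ^ 2 / 2)), mul_pos (Real.exp_pos (-(‖x‖ ^ 2 / 2))) (Real.exp_pos (-(‖x‖ ^ 2 / 2)))]

lemma integral_exp_neg_sq_norm_mul_coord (i j : Fin d) :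
    ∫ x : EuclideanSpace ℂ (Fin d), Real.exp (-‖x‖ ^ 2) * ‖x i‖ ^ 2 =
      ∫ x : EuclideanSpace ℂ (Fin d), Real.exp (-‖x‖ ^ 2) * ‖x j‖ ^ 2 := by
  let e : EuclideanSpace ℂ (Fin d) ≃ₗᵢ[ℝ] EuclideanSpace ℂ (Fin d) :=
    LinearIsometryEquiv.piLpCongrLeft 2 ℝ ℂ (Equiv.swap i j)
  have h := e.measurePreserving.integral_comp e.toHomeomorph.measurableEmbedding
    fun x ↦ Real.exp (-‖x‖ ^ 2) * ‖x i‖ ^ 2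
  have he : ∀ x, e x i = x j := fun x ↦ by
    simp [e, LinearIsometryEquiv.piLpCongrLeft_apply, Equiv.piCongrLeft'_apply]
  simp only [he, e.norm_map] at h
  exact h.symm

/-- After diagonalisation all coordinates share one second moment `J` by permutation symmetry; its
value is never needed. -/
lemma integral_exp_neg_sq_norm_mul_quadForm [NeZero d] {A : Matrix (Fin d) (Fin d) ℂ}
    (hA : A.IsHermitian) :
    ∫ x, Real.exp (-‖x‖ ^ 2) * quadForm A x =
      A.trace.re / d * ∫ x : EuclideanSpace ℂ (Fin d), Real.exp (-‖x‖ ^ 2) * ‖x‖ ^ 2 := by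
  have hd : 0 < d := Nat.pos_of_ne_zero (NeZero.ne d)
  have hd' : (d : ℝ) ≠ 0 := by positivity
  have hi : ∀ i, Integrable fun x : EuclideanSpace ℂ (Fin d) ↦
      Real.exp (-‖x‖ ^ 2) * ‖x i‖ ^ 2 := fun i ↦ by
    refine integrable_exp_neg_sq_norm_mul_sq_norm.mono' (by fun_prop)
      (.of_forall fun x ↦ ?_)
    rw [Real.norm_of_nonneg (by positivity)]
    gcongr
    exact PiLp.norm_apply_le x i
  set J := ∫ x : EuclideanSpace ℂ (Fin d), Real.exp (-‖x‖ ^ 2) * ‖x ⟨0, hd⟩‖ ^ 2 with hJ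
  have h1 : ∀ c : Fin d → ℝ, ∫ x : EuclideanSpace ℂ (Fin d),
      Real.exp (-‖x‖ ^ 2) * ∑ i, c i * ‖x i‖ ^ 2 = (∑ i, c i) * J := by
    intro c
    simp_rw [Finset.mul_sum, mul_left_comm _ (c _)]
    rw [integral_finsetSum _ fun i _ ↦ (hi i).const_mul (c i), Finset.sum_mul]
    refine Finset.sum_congr rfl fun i _ ↦ ?_
    rw [integral_const_mul, integral_exp_neg_sq_norm_mul_coord i ⟨0, hd⟩]
  have h2 : ∫ x : EuclideanSpace ℂ (Fin d), Real.exp (-‖x‖ ^ 2) * ‖x‖ ^ 2 = d * J := by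
    have := h1 fun _ ↦ 1
    simpa [← EuclideanSpace.norm_sq_eq] using this
  have h3 : ∀ x, Real.exp (-‖x‖ ^ 2) * quadForm A x =
      (fun y : EuclideanSpace ℂ (Fin d) ↦ Real.exp (-‖y‖ ^ 2) *
        ∑ i, hA.eigenvalues i * ‖y i‖ ^ 2) (hA.eigenvectorBasis.repr x) := fun x ↦ by
    rw [quadForm_eq_sum_eigenvalues hA]
    simp
  simp_rw [h3]
  rw [integral_comp_repr hA.eigenvectorBasis fun y : EuclideanSpace ℂ (Fin d) ↦
    Real.exp (-‖y‖ ^ 2) * ∑ i, hA.eigenvalues i * ‖y i‖ ^ 2, h1, h2, trace_re_eq_sum_eigenvalues hA]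
  field_simp

/-- The mean of a quadratic form on the sphere. -/
lemma integral_expVal_uniformSphere [NeZero d] {A : Matrix (Fin d) (Fin d) ℂ}
    (hA : A.IsHermitian) : ∫ v, expVal A v ∂uniformSphere d = A.trace.re / d := by
  have h1 := integral_sphere_eq (d := d) (F := quadForm A) 1
    fun r _ x ↦ by rw [quadForm_apply_smul, mul_one]
  -- Comparison with `‖x‖²`, identically 1 on the sphere, eliminates the unknown Gaussian second
  -- moment.
  have h2 := integral_sphere_eq (d := d) (F := fun x ↦ ‖x‖ ^ 2) 1
    fun r _ x ↦ by simp [norm_smul, mul_pow]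
  simp only [norm_eq_of_mem_sphere, one_pow, integral_const, probReal_univ, smul_eq_mul,
    mul_one] at h2
  simp only [expVal_eq_quadForm]
  rw [h1, integral_exp_neg_sq_norm_mul_quadForm hA, mul_left_comm (Real.pi ^ d)⁻¹, mul_left_comm,
    ← h2, mul_one]

/-- Absolute moments of a traceless observable, weighted by a density matrix. -/
lemma integral_exp_neg_sq_norm_mul_quadForm_mul_pow_le {ρ O : Matrix (Fin d) (Fin d) ℂ}
    (hρ : IsDensityMatrix ρ) (hO : O.IsHermitian) (htr : O.trace = 0) {N : ℝ} (hN : 0 < N)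
    (hON : hsNorm O ≤ N) (h : ℕ) :
    ∫ x, Real.exp (-‖x‖ ^ 2) * (quadForm ρ x * |quadForm O x| ^ h) ≤
      Real.pi ^ d * (16 * h.factorial * (4 * N) ^ h) := by
  -- This makes `‖t O‖ ≤ 1/4`; with `‖ρ / 4‖ ≤ 1/4`, both `B (± t)` satisfy `‖B‖² ≤ 1/4`, and their
  -- exponential integrals are at most `π ^ d * exp (1/4 + 1/4) ≤ 2 π ^ d`.
  set t : ℝ := (4 * N)⁻¹ with ht
  have htpos : 0 < t := by positivity
  let B : ℝ → Matrix (Fin d) (Fin d) ℂ := fun s ↦ s • O + (1 / 4 : ℝ) • ρ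
  have hB : ∀ s, (B s).IsHermitian := fun s ↦
    (hO.smul (IsSelfAdjoint.all s)).add (hρ.1.isHermitian.smul (IsSelfAdjoint.all _))
  have hBtr : ∀ s, (B s).trace.re = 1 / 4 := fun s ↦ by
    simp [B, Matrix.trace_add, Matrix.trace_smul, htr, hρ.2]
  have hBn : ∀ s, s ^ 2 = t ^ 2 → hsNorm (B s) ^ 2 ≤ 1 / 4 := fun s hs ↦ by
    have h1 := hsNorm_add_sq_le (s • O) ((1 / 4 : ℝ) • ρ)
    rw [hsNorm_smul_sq, hsNorm_smul_sq, hs] at h1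
    have h2 : t ^ 2 * hsNorm O ^ 2 ≤ 1 / 16 := by
      rw [← mul_pow, show (1 / 16 : ℝ) = (1 / 4) ^ 2 by norm_num]
      refine pow_le_pow_left₀ (mul_nonneg htpos.le (hsNorm_nonneg O)) ?_ 2
      rw [ht, inv_mul_le_iff₀ (by positivity)]
      linarith
    have h3 := hρ.hsNorm_sq_le_one
    calc _ ≤ _ := h1
      _ ≤ 1 / 4 := by linarith
  have hBn' : ∀ s, s ^ 2 = t ^ 2 → hsNorm (B s) ≤ 1 / 2 := fun s hs ↦
    le_of_sq_le_sq (by linarith [hBn s hs]) (by norm_num)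
  have hint : ∀ s, s ^ 2 = t ^ 2 → Integrable fun x : EuclideanSpace ℂ (Fin d) ↦
      Real.exp (-‖x‖ ^ 2 + quadForm (B s) x) := fun s hs ↦
    integrable_exp_quadForm (hB s) (by linarith [hBn' s hs])
  have hle : ∀ s, s ^ 2 = t ^ 2 → ∫ x : EuclideanSpace ℂ (Fin d),
      Real.exp (-‖x‖ ^ 2 + quadForm (B s) x) ≤ Real.pi ^ d * 2 := fun s hs ↦ by
    refine (integral_exp_quadForm_le (hB s) (hBn' s hs)).trans ?_
    gcongr
    rw [hBtr]
    calc Real.exp (1 / 4 + hsNorm (B s) ^ 2) ≤ Real.exp (1 / 2) := by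
          gcongr; linarith [hBn s hs]
      _ ≤ 2 := by
        have h1 : Real.exp (1 / 2) ^ 2 = Real.exp 1 := by rw [← Real.exp_nat_mul]; norm_num
        nlinarith [Real.exp_one_lt_d9, Real.exp_pos (1 / 2)]
  -- Uses `u ≤ 4 exp (u / 4)` for the weight, `u ^ h ≤ h! exp u` for the power, and `exp |u| ≤ exp u
  -- + exp (-u)` to drop the absolute value.
  have hpt : ∀ x : EuclideanSpace ℂ (Fin d),
      Real.exp (-‖x‖ ^ 2) * (quadForm ρ x * |quadForm O x| ^ h) ≤
        4 * (h.factorial * (4 * N) ^ h) * (Real.exp (-‖x‖ ^ 2 + quadForm (B t) x) +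
          Real.exp (-‖x‖ ^ 2 + quadForm (B (-t)) x)) := fun x ↦ by
    have h0 := quadForm_nonneg hρ.1 x
    have h1 : quadForm ρ x ≤ 4 * Real.exp (1 / 4 * quadForm ρ x) := by
      linarith [Real.add_one_le_exp (1 / 4 * quadForm ρ x)]
    have h2 : (t * |quadForm O x|) ^ h ≤ h.factorial *
        (Real.exp (t * quadForm O x) + Real.exp (-t * quadForm O x)) := by
      have h3 := Real.pow_div_factorial_le_exp (t * |quadForm O x|) (by positivity) h
      rw [div_le_iff₀' (by positivity)] at h3
      refine h3.trans ?_
      gcongr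
      rw [neg_mul, ← abs_of_pos htpos, ← abs_mul, abs_of_pos htpos]
      exact Real.exp_abs_le _
    have h3 : |quadForm O x| ^ h = (4 * N) ^ h * (t * |quadForm O x|) ^ h := by
      rw [← mul_pow, ht, ← mul_assoc, mul_inv_cancel₀ (by positivity), one_mul]
    calc Real.exp (-‖x‖ ^ 2) * (quadForm ρ x * |quadForm O x| ^ h)
        ≤ Real.exp (-‖x‖ ^ 2) * ((4 * Real.exp (1 / 4 * quadForm ρ x)) * ((4 * N) ^ h *
          (h.factorial * (Real.exp (t * quadForm O x) + Real.exp (-t * quadForm O x))))) := by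
          rw [h3]
          gcongr
      _ = _ := by
          simp only [B, quadForm_add, quadForm_smul, Real.exp_add]
          ring
  have hs : (-t) ^ 2 = t ^ 2 := neg_sq t
  calc ∫ x, Real.exp (-‖x‖ ^ 2) * (quadForm ρ x * |quadForm O x| ^ h)
      ≤ ∫ x, 4 * (h.factorial * (4 * N) ^ h) * (Real.exp (-‖x‖ ^ 2 + quadForm (B t) x) +
          Real.exp (-‖x‖ ^ 2 + quadForm (B (-t)) x)) := by
        refine integral_mono_of_nonneg (.of_forall fun x ↦ ?_)
          (((hint t rfl).add (hint _ hs)).const_mul _) (.of_forall hpt)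
        have := quadForm_nonneg hρ.1 x
        simp only [Pi.zero_apply]
        positivity
    _ ≤ 4 * (h.factorial * (4 * N) ^ h) * (Real.pi ^ d * 2 + Real.pi ^ d * 2) := by
        rw [integral_const_mul, integral_add (hint t rfl) (hint _ hs)]
        gcongr
        exacts [hle t rfl, hle _ hs]
    _ = _ := by ring

/-- The density's factor `d` turns `(d-1)!` into `d!`, and `(d+h)! / d!` is a product of `h`
factors, each at least `d + 1`. -/
lemma factorial_ratio_le (hd : 0 < d) (h : ℕ) :
    (d : ℝ) * ((d - 1).factorial / (d + (h + 1) - 1).factorial) ≤ (((d : ℝ) + 1) ^ h)⁻¹ := by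
  have h1 : (d : ℝ) * (d - 1).factorial = d.factorial := by
    exact_mod_cast Nat.mul_factorial_pred hd.ne'
  have h2 : d.factorial * (d + 1) ^ h ≤ (d + h).factorial := Nat.factorial_mul_pow_le_factorial
  rw [← mul_div_assoc, h1, show d + (h + 1) - 1 = d + h by omega, div_le_iff₀ (by positivity),
    inv_mul_eq_div, le_div_iff₀ (by positivity)]
  exact_mod_cast h2

/-- Absolute moments of a traceless observable on the sphere. -/
lemma integral_sphere_expVal_mul_pow_le [NeZero d] {ρ O : Matrix (Fin d) (Fin d) ℂ}
    (hρ : IsDensityMatrix ρ) (hO : O.IsHermitian) (htr : O.trace = 0) {N : ℝ} (hN : 0 < N)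
    (hON : hsNorm O ≤ N) (h : ℕ) :
    ∫ v, d * expVal ρ v * |expVal O v| ^ h ∂uniformSphere d ≤
      16 * h.factorial * (4 * N / (d + 1)) ^ h := by
  have h1 := integral_sphere_eq (d := d) (F := fun x ↦ quadForm ρ x * |quadForm O x| ^ h) (h + 1)
    fun r hr x ↦ by
      simp only [quadForm_apply_smul, abs_mul, abs_of_pos (pow_pos hr 2)]
      ring
  simp only [mul_assoc, integral_const_mul]
  simp only [expVal_eq_quadForm]
  rw [h1]
  have hpi : 0 < Real.pi ^ d := by positivity
  have h2 := integral_exp_neg_sq_norm_mul_quadForm_mul_pow_le hρ hO htr hN hON h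
  rw [← inv_mul_le_iff₀ hpi] at h2
  calc _ = (d : ℝ) * ((d - 1).factorial / (d + (h + 1) - 1).factorial) * _ := (mul_assoc _ _ _).symm
    _ ≤ (((d : ℝ) + 1) ^ h)⁻¹ * (16 * h.factorial * (4 * N) ^ h) := by
        refine mul_le_mul (factorial_ratio_le (Nat.pos_of_ne_zero (NeZero.ne d)) h) h2 ?_
          (by positivity)
        refine mul_nonneg (by positivity) (integral_nonneg fun x ↦ ?_)
        have := quadForm_nonneg hρ.1 x
        simp only [Pi.zero_apply]
        positivity
    _ = _ := by rw [div_pow]; ring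

end Sphere

/-! ### From factorial moment bounds to concentration -/

section SubExponential
variable {Ω : Type*} [MeasurableSpace Ω] {μ : Measure Ω}

lemma centralMoment_le_of_factorial {X : Ω → ℝ} {b : ℝ} (hb : 0 ≤ b) (h : ℕ)
    (hmom : ∫ ω, |X ω - ∫ ω', X ω' ∂μ| ^ h ∂μ ≤ h.factorial * b ^ h) :
    centralMoment X h μ ≤ (b * h) ^ h := by
  calc centralMoment X h μ ≤ ∫ ω, |X ω - ∫ ω', X ω' ∂μ| ^ h ∂μ := by
        refine (le_abs_self _).trans ?_
        simpa [centralMoment] using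
          norm_integral_le_integral_norm (μ := μ) fun ω ↦ (X ω - ∫ ω', X ω' ∂μ) ^ h
    _ ≤ h.factorial * b ^ h := hmom
    _ ≤ (h : ℝ) ^ h * b ^ h := by
        gcongr
        exact_mod_cast Nat.factorial_le_pow h
    _ = _ := by rw [mul_pow, mul_comm]

variable [IsProbabilityMeasure μ]

lemma integrable_pow_abs_sub {X : Ω → ℝ} {M : ℝ} (hX : AEStronglyMeasurable X μ)
    (hM : ∀ ω, |X ω| ≤ M) (c : ℝ) (h : ℕ) : Integrable (fun ω ↦ |X ω - c| ^ h) μ := by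
  refine .of_bound ((hX.sub aestronglyMeasurable_const).norm.pow h) ((M + |c|) ^ h)
    (.of_forall fun ω ↦ ?_)
  rw [Real.norm_of_nonneg (by positivity)]
  gcongr
  exact (abs_sub _ _).trans (by gcongr; exact hM ω)

/-- Factorial bounds on absolute moments pass from any centre to the mean. -/
lemma integral_abs_sub_mean_pow_le {X : Ω → ℝ} {M c a : ℝ} (hX : AEStronglyMeasurable X μ)
    (hM : ∀ ω, |X ω| ≤ M) (ha : 0 ≤ a)
    (hmom : ∀ h : ℕ, 1 ≤ h → ∫ ω, |X ω - c| ^ h ∂μ ≤ 16 * h.factorial * a ^ h) (h : ℕ) :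
    ∫ ω, |X ω - ∫ ω', X ω' ∂μ| ^ h ∂μ ≤ h.factorial * (32 * a) ^ h := by
  rcases Nat.eq_zero_or_pos h with rfl | hh
  · simp
  set m := ∫ ω, X ω ∂μ with hm
  have hXi : Integrable X μ := .of_bound hX M (.of_forall hM)
  -- The distance between the centres is controlled by the first moment about `c`.
  have hmc : |c - m| ≤ 16 * a := by
    have h1 : m - c = ∫ ω, (X ω - c) ∂μ := by
      rw [integral_sub hXi (integrable_const c)]
      simp [hm]
    rw [abs_sub_comm, h1]
    refine (abs_integral_le_integral_abs).trans ?_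
    simpa using hmom 1 le_rfl
  have hpt : ∀ ω, |X ω - m| ^ h ≤ 2 ^ (h - 1) * (|X ω - c| ^ h + (16 * a) ^ h) := fun ω ↦ by
    refine le_trans ?_ (add_pow_le (abs_nonneg (X ω - c)) (by positivity) h)
    gcongr
    exact (abs_sub_le (X ω) c m).trans (by gcongr)
  have hic := integrable_pow_abs_sub hX hM c h
  calc ∫ ω, |X ω - m| ^ h ∂μ ≤ ∫ ω, 2 ^ (h - 1) * (|X ω - c| ^ h + (16 * a) ^ h) ∂μ :=
        integral_mono (integrable_pow_abs_sub hX hM m h)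
          ((hic.add (integrable_const _)).const_mul _) hpt
    _ = 2 ^ (h - 1) * (∫ ω, |X ω - c| ^ h ∂μ + (16 * a) ^ h) := by
        rw [integral_const_mul, integral_add hic (integrable_const _)]
        simp
    -- Since `h ≥ 1`, the prefactor 16 is absorbed into `16 ^ h`; the two equal terms then turn `2 ^
    -- (h - 1)` into `2 ^ h`, giving `32 = 2 * 16`.
    _ ≤ 2 ^ (h - 1) * (16 ^ h * h.factorial * a ^ h + h.factorial * (16 * a) ^ h) := by
        have h1 : (1 : ℝ) ≤ h.factorial := by exact_mod_cast h.factorial_pos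
        have h2 : (16 : ℝ) ≤ 16 ^ h := le_self_pow₀ (by norm_num) hh.ne'
        gcongr
        · exact (hmom h hh).trans (by gcongr)
        · exact le_mul_of_one_le_left (by positivity) h1
    _ = h.factorial * (32 * a) ^ h := by
        obtain ⟨n, rfl⟩ := Nat.exists_eq_add_of_le' hh
        rw [show (32 : ℝ) * a = 2 * (16 * a) by ring, mul_pow 2, mul_pow 16 a, Nat.add_sub_cancel,
          pow_succ (2 : ℝ)]
        ring

/-- Expand the exponential: the linear term vanishes by centring, and with `q = |s| b ≤ 1/2` the
tail is at most `q² / (1 - q) ≤ 2 q² = s² (2b)² / 2`. This is the source of the parameter `2b`. -/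
lemma isSubExponential_of_factorial {X : Ω → ℝ} {M b : ℝ} (hX : AEStronglyMeasurable X μ)
    (hM : ∀ ω, |X ω| ≤ M) (hb : 0 ≤ b)
    (hmom : ∀ h : ℕ, ∫ ω, |X ω - ∫ ω', X ω' ∂μ| ^ h ∂μ ≤ h.factorial * b ^ h) :
    IsSubExponential X (2 * b) μ := by
  have hXi : Integrable X μ := .of_bound hX M (.of_forall hM)
  refine ⟨hXi, by positivity, fun s hs ↦ ?_⟩
  set m := ∫ ω, X ω ∂μ with hm
  have hmeas : AEStronglyMeasurable (fun ω ↦ X ω - m) μ := hX.sub aestronglyMeasurable_const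
  have hbd : ∀ ω, |X ω - m| ≤ M + |m| := fun ω ↦ (abs_sub _ _).trans (by gcongr; exact hM ω)
  refine ⟨.of_bound (Real.continuous_exp.comp_aestronglyMeasurable (hmeas.const_mul s))
    (Real.exp (|s| * (M + |m|))) (.of_forall fun ω ↦ ?_), ?_⟩
  · rw [Real.norm_of_nonneg (Real.exp_pos _).le]
    refine Real.exp_le_exp.2 ((le_abs_self _).trans ?_)
    rw [abs_mul]
    gcongr
    exact hbd ω
  set q := |s| * b with hq
  have hq0 : 0 ≤ q := by positivity
  have hq2 : q ≤ 1 / 2 := by rw [hq]; linarith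
  let F : ℕ → Ω → ℝ := fun n ω ↦ (s * (X ω - m)) ^ n / n.factorial
  have hFn : ∀ n ω, ‖F n ω‖ = |s| ^ n / n.factorial * |X ω - m| ^ n := fun n ω ↦ by
    simp only [F, norm_div, norm_pow, norm_mul, Real.norm_eq_abs, Nat.abs_cast, mul_pow]
    ring
  have hFi : ∀ n, Integrable (F n) μ := fun n ↦ by
    refine (((integrable_pow_abs_sub hX hM m n).const_mul (|s| ^ n / n.factorial))).mono'
      ((continuous_pow n |>.div_const _).comp_aestronglyMeasurable (hmeas.const_mul s)) (.of_forall fun ω ↦ (hFn n ω).le)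
  have hFle : ∀ n, ∫ ω, ‖F n ω‖ ∂μ ≤ q ^ n := fun n ↦ by
    simp_rw [hFn]
    rw [integral_const_mul, hq, mul_pow, div_mul_eq_mul_div, div_le_iff₀ (by positivity)]
    calc |s| ^ n * ∫ ω, |X ω - m| ^ n ∂μ ≤ |s| ^ n * (n.factorial * b ^ n) := by
          gcongr; exact hmom n
      _ = _ := by ring
  have hqs : Summable fun n ↦ q ^ n := summable_geometric_of_lt_one hq0 (by linarith)
  have hsum : HasSum (fun n ↦ ∫ ω, F n ω ∂μ) (∫ ω, ∑' n, F n ω ∂μ) :=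
    hasSum_integral_of_summable_integral_norm hFi
      (hqs.of_nonneg_of_le (fun n ↦ integral_nonneg fun ω ↦ norm_nonneg _) hFle)
  have hexp : ∀ ω, Real.exp (s * (X ω - m)) = ∑' n, F n ω := fun ω ↦ by
    rw [Real.exp_eq_exp_ℝ, NormedSpace.exp_eq_tsum_div]
  simp_rw [hexp]
  rw [← hsum.tsum_eq, ← hsum.summable.sum_add_tsum_nat_add 2]
  have h0 : ∫ ω, F 0 ω ∂μ = 1 := by simp [F]
  have h1 : ∫ ω, F 1 ω ∂μ = 0 := by
    simp only [F, pow_one, Nat.factorial_one, Nat.cast_one, div_one]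
    rw [integral_const_mul, integral_sub hXi (integrable_const m)]
    simp [hm]
  have htail : ∑' n, ∫ ω, F (n + 2) ω ∂μ ≤ q ^ 2 * (1 - q)⁻¹ := by
    rw [← tsum_geometric_of_lt_one hq0 (by linarith), ← tsum_mul_left]
    refine Summable.tsum_le_tsum (fun n ↦ ?_) ((summable_nat_add_iff 2).2 hsum.summable)
      (hqs.mul_left _)
    rw [← pow_add, add_comm 2 n]
    exact ((le_abs_self _).trans (norm_integral_le_integral_norm (F (n + 2)))).trans (hFle _)
  have hinv : (1 - q)⁻¹ ≤ 2 := by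
    rw [inv_le_comm₀ (by linarith) two_pos]
    linarith
  have hs2 : s ^ 2 * (2 * b) ^ 2 / 2 = 2 * q ^ 2 := by
    rw [hq, mul_pow |s|, sq_abs]
    ring
  rw [Finset.sum_range_succ, Finset.sum_range_one, h0, h1, hs2]
  nlinarith [Real.add_one_le_exp (2 * q ^ 2), mul_le_mul_of_nonneg_left hinv (sq_nonneg q)]

end SubExponential

/-! ### The measurement distribution -/

section UniformPOVM
variable {d : ℕ}

lemma continuous_expVal (A : Matrix (Fin d) (Fin d) ℂ) : Continuous (expVal A) :=
  (continuous_quadForm A).comp continuous_subtype_val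

lemma expVal_nonneg {ρ : Matrix (Fin d) (Fin d) ℂ} (hρ : ρ.PosSemidef) (v : UnitSphere d) :
    0 ≤ expVal ρ v := quadForm_nonneg hρ v.1

lemma exists_abs_expVal_le (A : Matrix (Fin d) (Fin d) ℂ) : ∃ M, ∀ v, |expVal A v| ≤ M := by
  obtain ⟨M, hM⟩ := isCompact_univ.exists_bound_of_continuousOn (continuous_expVal A).continuousOn
  exact ⟨M, fun v ↦ hM v (Set.mem_univ v)⟩

lemma expVal_add_smul_one (A : Matrix (Fin d) (Fin d) ℂ) (c : ℝ) (v : UnitSphere d) :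
    expVal (A + c • (1 : Matrix (Fin d) (Fin d) ℂ)) v = expVal A v + c := by
  simp only [expVal_eq_quadForm, quadForm_add, quadForm_smul, quadForm_one]
  simp

lemma integral_uniformPOVM {ρ : Matrix (Fin d) (Fin d) ℂ} (hρ : ρ.PosSemidef)
    (f : UnitSphere d → ℝ) :
    ∫ v, f v ∂uniformPOVM ρ = ∫ v, d * expVal ρ v * f v ∂uniformSphere d := by
  have hm : Measurable fun v ↦ ((d : ℝ) * expVal ρ v).toNNReal :=
    ((continuous_expVal ρ).measurable.const_mul _).real_toNNReal
  simp only [uniformPOVM, ENNReal.ofReal]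
  rw [integral_withDensity_eq_integral_smul hm]
  refine integral_congr_ae (.of_forall fun v ↦ ?_)
  have := expVal_nonneg hρ v
  simp only [NNReal.smul_def, smul_eq_mul]
  rw [Real.coe_toNNReal _ (by positivity)]

lemma IsDensityMatrix.isProbabilityMeasure_uniformPOVM [NeZero d]
    {ρ : Matrix (Fin d) (Fin d) ℂ} (hρ : IsDensityMatrix ρ) :
    IsProbabilityMeasure (uniformPOVM ρ) := by
  obtain ⟨M, hM⟩ := exists_abs_expVal_le ρ
  constructor
  rw [uniformPOVM, withDensity_apply _ .univ, Measure.restrict_univ,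
    ← ofReal_integral_eq_lintegral_ofReal, integral_const_mul,
    integral_expVal_uniformSphere hρ.1.isHermitian, hρ.2]
  · have : (d : ℝ) ≠ 0 := by exact_mod_cast NeZero.ne d
    simp [this]
  · exact (Integrable.of_bound (continuous_expVal ρ).aestronglyMeasurable M
      (.of_forall hM)).const_mul _
  · exact .of_forall fun v ↦ mul_nonneg (by positivity) (expVal_nonneg hρ.1 v)

/-- The centre `tr O / d` is the Haar mean, not the mean under `uniformPOVM ρ`: it is what makes the
observable traceless. -/
lemma integral_abs_expVal_sub_pow_le [NeZero d] {ρ O : Matrix (Fin d) (Fin d) ℂ}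
    (hρ : IsDensityMatrix ρ) (hO : O.IsHermitian) (h : ℕ) (hh : 1 ≤ h) :
    ∫ v, |expVal O v - O.trace.re / d| ^ h ∂uniformPOVM ρ ≤
      16 * h.factorial * (4 * hsNorm O / (d + 1)) ^ h := by
  -- `O = 0` is split off because the traceless bound needs a positive scale `N`.
  rcases (hsNorm_nonneg O).eq_or_lt with h0 | hpos
  · obtain rfl := eq_zero_of_hsNorm_eq_zero h0.symm
    have hh' : h ≠ 0 := by omega
    simp [expVal, ← h0, hh']
  have hd : (d : ℂ) ≠ 0 := by exact_mod_cast NeZero.ne d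
  have htr : (O + (-(O.trace.re / d)) • (1 : Matrix (Fin d) (Fin d) ℂ)).trace = 0 := by
    have him : (O.trace.re : ℂ) = O.trace := by
      rw [trace_re_eq_sum_eigenvalues hO, hO.trace_eq_sum_eigenvalues]
      simp
    rw [Matrix.trace_add, Matrix.trace_smul, Matrix.trace_one, Fintype.card_fin, ← him,
      Complex.real_smul]
    push_cast
    field_simp
    simp
  have hH : (O + (-(O.trace.re / d)) • (1 : Matrix (Fin d) (Fin d) ℂ)).IsHermitian :=
    hO.add (Matrix.isHermitian_one.smul (IsSelfAdjoint.all _))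
  have key := integral_sphere_expVal_mul_pow_le hρ hH htr hpos (hsNorm_sub_trace_sq_le hO) h
  simp only [expVal_add_smul_one, ← sub_eq_add_neg] at key
  rwa [integral_uniformPOVM hρ.1]

end UniformPOVM

theorem mainTheorem4 :
    ∃ C : ℝ, 0 < C ∧
      ∀ (d : ℕ) (ρ O : Matrix (Fin d) (Fin d) ℂ), IsDensityMatrix ρ → O.IsHermitian →
        (∀ h : ℕ, 2 ≤ h →
          centralMoment (expVal O) h (uniformPOVM ρ) ≤ (C * h * hsNorm O / ((d : ℝ) + 1)) ^ h) ∧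
        IsSubExponential (expVal O) (C * hsNorm O / ((d : ℝ) + 1)) (uniformPOVM ρ) := by
  -- `256 = 2 * 32 * 4`: scale 4 from the Gaussian bound, 32 from recentring, 2 from the exponential
  -- series; the moments alone need 128.
  refine ⟨256, by norm_num, fun d ρ O hρ hO ↦ ?_⟩
  -- In dimension 0 the trace is 0, so no density matrix exists.
  have : NeZero d := ⟨by
    rintro rfl
    simpa [Matrix.trace] using hρ.2⟩
  have := hρ.isProbabilityMeasure_uniformPOVM
  have hn := hsNorm_nonneg O
  have ha : 0 ≤ 4 * hsNorm O / ((d : ℝ) + 1) := by positivity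
  obtain ⟨M, hM⟩ := exists_abs_expVal_le O
  have hX : AEStronglyMeasurable (expVal O) (uniformPOVM ρ) :=
    (continuous_expVal O).aestronglyMeasurable
  have hmom := integral_abs_sub_mean_pow_le hX hM ha (integral_abs_expVal_sub_pow_le hρ hO)
  have hb : 0 ≤ 32 * (4 * hsNorm O / ((d : ℝ) + 1)) := by positivity
  refine ⟨fun h _ ↦ (centralMoment_le_of_factorial hb h (hmom h)).trans ?_, ?_⟩
  · gcongr ?_ ^ h
    calc 32 * (4 * hsNorm O / ((d : ℝ) + 1)) * h = 128 * h * hsNorm O / (d + 1) := by ring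
      _ ≤ 256 * h * hsNorm O / (d + 1) := by gcongr; norm_num
  · convert isSubExponential_of_factorial hX hM hb hmom using 1
    ring
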